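/- For $x\in\{0,1\}^n$ and $S\subseteq[n]=\{1,\dots,n\}$, let $x^S$ denote the vector obtained from $x$ by flipping all coordinates in $S$. For a boolean function $f:\{0,1\}^n\to\{0,1\}$, the sensitivity of $f$ is $$s(f)=\max_{x\in\{0,1\}^n}\bigl|\{i\in[n]: f(x)\neq f(x^{\{i\}})\}\bigr|,$$ and the block sensitivity $bs(f)$ is the maximum, over all $x\in\{0,1\}^n$, of the largest $k\ge 0$ for which there are pairwise disjoint blocks $B_1,\dots,B_k\subseteq[n]$ with $f(x)\neq f(x^{B_j})$ for every $j=1,\dots,k$. **Theorem.** For every $n$ and every boolean function $f:\{0,1\}^n\to\{0,1\}$, $$bs(f)\le s(f)^4.$$ -/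

import Mathlib

namespace BooleanFunction

/-- The vector `x^S`: the binary vector obtained from `x` by flipping all coordinates in `S`. -/
def flip {n : ℕ} (x : Fin n → Bool) (S : Finset (Fin n)) : Fin n → Bool :=
  fun i => if i ∈ S then !(x i) else x i

/-- The local sensitivity `s(f, x)`: the number of indices `i` with `f(x) ≠ f(x^{i})`. -/
def localSensitivity {n : ℕ} (f : (Fin n → Bool) → Bool) (x : Fin n → Bool) : ℕ :=
  (Finset.univ.filter fun i : Fin n => f x ≠ f (flip x {i})).card

/-- The sensitivity `s(f)`: the maximum of `s(f, x)` over all inputs `x`. -/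
def sensitivity {n : ℕ} (f : (Fin n → Bool) → Bool) : ℕ :=
  Finset.univ.sup fun x : Fin n → Bool => localSensitivity f x

/-- A family of pairwise disjoint blocks, each of which changes the value of `f` when flipped
at `x`. Such blocks are automatically nonempty, so disjoint ones are distinct and a set of
blocks records the same number as a list of blocks. -/
def IsSensitiveFamily {n : ℕ} (f : (Fin n → Bool) → Bool) (x : Fin n → Bool)
    (F : Finset (Finset (Fin n))) : Prop :=
  (∀ A ∈ F, ∀ B ∈ F, A ≠ B → Disjoint A B) ∧ ∀ B ∈ F, f x ≠ f (flip x B)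

instance {n : ℕ} (f : (Fin n → Bool) → Bool) (x : Fin n → Bool) :
    DecidablePred (IsSensitiveFamily f x) :=
  fun F => inferInstanceAs (Decidable
    ((∀ A ∈ F, ∀ B ∈ F, A ≠ B → Disjoint A B) ∧ ∀ B ∈ F, f x ≠ f (flip x B)))

/-- The local block sensitivity `bs(f, x)`: the maximum number of pairwise disjoint blocks
`B_1, …, B_k` of indices with `f(x) ≠ f(x^{B_i})` for each `i`. -/
def localBlockSensitivity {n : ℕ} (f : (Fin n → Bool) → Bool) (x : Fin n → Bool) : ℕ :=
  (Finset.univ.filter fun F : Finset (Finset (Fin n)) => IsSensitiveFamily f x F).sup Finset.card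

/-- The block sensitivity `bs(f)`: the maximum of `bs(f, x)` over all inputs `x`. -/
def blockSensitivity {n : ℕ} (f : (Fin n → Bool) → Bool) : ℕ :=
  Finset.univ.sup fun x : Fin n → Bool => localBlockSensitivity f x

end BooleanFunction

namespace BooleanFunction

open Finset

variable {n : ℕ}

/-! Two bounds are chained through the Fourier degree of `sgn ∘ f`. Huang's signed cube operator
bounds this degree by `s(f)^2` (`card_le_sensitivity_sq`). For disjoint sensitive blocks `F` at `x`,
flipping each independently with probability `t` gives a polynomial `blockPoly` of no larger degree,
bounded by 1 on `[0,1]`, with slope `-2 * #F` at 0. Markov's endpoint inequality then yields `#F ≤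
(s(f)^2)^2`. -/

/-- The sign `(-1)^b` of a bit. -/
def sgn (b : Bool) : ℝ := if b then -1 else 1

lemma sgn_mul_self (b : Bool) : sgn b * sgn b = 1 := by cases b <;> simp [sgn]

lemma abs_sgn (b : Bool) : |sgn b| = 1 := by cases b <;> simp [sgn]

lemma sgn_not (b : Bool) : sgn (!b) = -sgn b := by cases b <;> simp [sgn]

lemma sgn_mul_of_ne {a b : Bool} (h : a ≠ b) : sgn a * sgn b = -1 := by
  cases a <;> cases b <;> simp_all [sgn]

/-- The Fourier character `χ_S(x) = (-1)^{∑ i ∈ S, x_i}`. -/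
def chi (S : Finset (Fin n)) (x : Fin n → Bool) : ℝ := ∏ i ∈ S, sgn (x i)

lemma abs_chi (S : Finset (Fin n)) (x : Fin n → Bool) : |chi S x| = 1 := by
  simp [chi, Finset.abs_prod, abs_sgn]

lemma chi_mul_self (S : Finset (Fin n)) (x : Fin n → Bool) : chi S x * chi S x = 1 := by
  rw [chi, ← prod_mul_distrib]
  simp [sgn_mul_self]

lemma chi_flip (S B : Finset (Fin n)) (x : Fin n → Bool) :
    chi S (flip x B) = (-1) ^ #(S ∩ B) * chi S x := by
  have h : ∀ i, sgn (flip x B i) = (if i ∈ B then -1 else 1) * sgn (x i) := by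
    intro i
    by_cases hi : i ∈ B <;> simp [flip, hi, sgn_not]
  simp only [chi, h, prod_mul_distrib]
  rw [prod_ite_mem, prod_const]

lemma chi_flip_singleton (S : Finset (Fin n)) (i : Fin n) (x : Fin n → Bool) :
    chi S (flip x {i}) = (if i ∈ S then -1 else 1) * chi S x := by
  rw [chi_flip]
  by_cases hi : i ∈ S <;> simp [hi]

lemma flip_flip_self (x : Fin n → Bool) (B : Finset (Fin n)) : flip (flip x B) B = x := by
  funext j
  by_cases hj : j ∈ B <;> simp [flip, hj]

lemma flip_comm (x : Fin n → Bool) (A B : Finset (Fin n)) :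
    flip (flip x A) B = flip (flip x B) A := by
  funext j
  by_cases hA : j ∈ A <;> by_cases hB : j ∈ B <;> simp [flip, hA, hB]

lemma flip_empty (x : Fin n → Bool) : flip x ∅ = x := by
  funext j
  simp [flip]

lemma sum_chi_mul_chi (x y : Fin n → Bool) :
    ∑ S, chi S x * chi S y = if x = y then 2 ^ n else 0 := by
  have h : ∑ S, chi S x * chi S y = ∏ i, (sgn (x i) * sgn (y i) + 1) := by
    rw [prod_add_one, powerset_univ]
    simp only [chi, prod_mul_distrib]
  rw [h]
  split_ifs with hxy
  · subst hxy
    simp only [sgn_mul_self, prod_const, card_univ, Fintype.card_fin]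
    norm_num
  · obtain ⟨i, hi⟩ := Function.ne_iff.mp hxy
    exact prod_eq_zero (mem_univ i) (by rw [sgn_mul_of_ne hi]; norm_num)

/-- The (unnormalised) Fourier coefficients of the sign function of `f`. -/
def fourier (f : (Fin n → Bool) → Bool) (S : Finset (Fin n)) : ℝ :=
  ∑ y, chi S y * sgn (f y)

lemma sum_fourier_mul_chi (f : (Fin n → Bool) → Bool) (x : Fin n → Bool) :
    ∑ S, fourier f S * chi S x = 2 ^ n * sgn (f x) := by
  simp only [fourier, sum_mul]
  rw [sum_comm]
  have h : ∀ y, ∑ S, chi S y * sgn (f y) * chi S x = if y = x then 2 ^ n * sgn (f x) else 0 := by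
    intro y
    have : ∑ S, chi S y * sgn (f y) * chi S x = (∑ S, chi S y * chi S x) * sgn (f y) := by
      rw [sum_mul]
      exact sum_congr rfl fun S _ => by ring
    rw [this, sum_chi_mul_chi]
    split_ifs with hyx <;> simp [hyx]
  simp [h]

/-! ### Huang's theorem on induced subgraphs of the cube -/

/-- Huang's signed adjacency operator of the hypercube, restricted to the directions in `S`. -/
def signedAdj (S : Finset (Fin n)) : ((Fin n → Bool) → ℝ) →ₗ[ℝ] ((Fin n → Bool) → ℝ) where
  toFun v x := ∑ i ∈ S, chi (Iio i) x * v (flip x {i})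
  map_add' v w := by
    funext x
    simp [mul_add, sum_add_distrib]
  map_smul' c v := by
    funext x
    simp only [Pi.smul_apply, smul_eq_mul, RingHom.id_apply, mul_sum]
    exact sum_congr rfl fun i _ => by ring

lemma signedAdj_apply (S : Finset (Fin n)) (v : (Fin n → Bool) → ℝ) (x : Fin n → Bool) :
    signedAdj S v x = ∑ i ∈ S, chi (Iio i) x * v (flip x {i}) := rfl

/-- Two-step walks in directions `i < j` cancel in pairs: flipping `i` negates `chi (Iio j)`, while
flipping `j` preserves `chi (Iio i)`. Only the returning walks `i = j` survive. -/
lemma signedAdj_signedAdj (S : Finset (Fin n)) (v : (Fin n → Bool) → ℝ) :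
    signedAdj S (signedAdj S v) = (#S : ℝ) • v := by
  funext x
  set F : Fin n → Fin n → ℝ := fun i j =>
    chi (Iio i) x * (chi (Iio j) (flip x {i}) * v (flip (flip x {i}) {j})) with hF
  have hdiag : ∀ i, F i i = v x := by
    intro i
    simp only [hF, flip_flip_self, chi_flip_singleton, mem_Iio, lt_irrefl, if_false, one_mul]
    rw [← mul_assoc, chi_mul_self, one_mul]
  have hoff : ∀ i j, F i j + F j i = if i = j then 2 * v x else 0 := by
    intro i j
    split_ifs with hij
    · subst hij
      rw [hdiag]
      ring
    · simp only [hF, chi_flip_singleton, mem_Iio]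
      rw [flip_comm x {j} {i}]
      rcases lt_or_gt_of_ne hij with h | h
      · rw [if_pos h, if_neg h.not_gt]
        ring
      · rw [if_pos h, if_neg h.not_gt]
        ring
  have hsum : ∑ i ∈ S, ∑ j ∈ S, F i j + ∑ i ∈ S, ∑ j ∈ S, F i j = 2 * (#S * v x) := by
    nth_rw 2 [sum_comm]
    simp only [← sum_add_distrib, hoff, sum_ite_eq]
    rw [sum_congr rfl fun i hi => if_pos hi]
    simp only [sum_const, nsmul_eq_mul]
    ring
  simp only [signedAdj_apply, Pi.smul_apply, smul_eq_mul, mul_sum]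
  change ∑ i ∈ S, ∑ j ∈ S, F i j = _
  linarith

lemma exists_support_subset_of_finrank_range_lt {α : Type*} [Fintype α]
    (P : (α → ℝ) →ₗ[ℝ] (α → ℝ)) (W : Finset α)
    (h : Module.finrank ℝ (LinearMap.range P) < #W) :
    ∃ v : α → ℝ, v ≠ 0 ∧ P v = 0 ∧ ∀ x, v x ≠ 0 → x ∈ W := by
  let E : (W → ℝ) →ₗ[ℝ] (α → ℝ) := Function.ExtendByZero.linearMap ℝ (Subtype.val : W → α)
  have hE : ∀ (u : W → ℝ) (w : W), E u w = u w := fun u w =>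
    Subtype.val_injective.extend_apply u 0 w
  obtain ⟨u, hu, hu0⟩ := (Submodule.ne_bot_iff _).mp
    (LinearMap.ker_ne_bot_of_finrank_lt (f := P.rangeRestrict ∘ₗ E) (by simpa using h))
  refine ⟨E u, fun h0 => hu0 ?_, ?_, fun x hx => ?_⟩
  · funext w
    rw [← hE u w, h0]
    rfl
  · simpa using congrArg Subtype.val (LinearMap.mem_ker.mp hu)
  · by_contra hxW
    exact hx (Function.extend_apply' (f := Subtype.val) u 0 x fun ⟨w, hw⟩ => hxW (hw ▸ w.2))

/-- Since `(A - r)(A + r) = 0`, the ranks of the two factors sum to at most `2 ^ n`, so one is below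
`#W` and kills a nonzero vector supported on `W`. -/
lemma exists_eigenvector_support_subset (S : Finset (Fin n)) (W : Finset (Fin n → Bool))
    (hW : 2 ^ n < 2 * #W) :
    ∃ v : (Fin n → Bool) → ℝ, v ≠ 0 ∧ (∀ x, |signedAdj S v x| = √(#S) * |v x|) ∧
      ∀ x, v x ≠ 0 → x ∈ W := by
  set r : ℝ := √(#S)
  have hrr : r * r = #S := Real.mul_self_sqrt (Nat.cast_nonneg _)
  let P : ((Fin n → Bool) → ℝ) →ₗ[ℝ] ((Fin n → Bool) → ℝ) := signedAdj S + r • LinearMap.id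
  let Q : ((Fin n → Bool) → ℝ) →ₗ[ℝ] ((Fin n → Bool) → ℝ) := signedAdj S - r • LinearMap.id
  have hle : LinearMap.range P ≤ LinearMap.ker Q := by
    rintro _ ⟨v, rfl⟩
    rw [LinearMap.mem_ker]
    funext x
    simp only [P, Q, LinearMap.add_apply, LinearMap.sub_apply, LinearMap.smul_apply,
      LinearMap.id_apply, map_add, map_smul, signedAdj_signedAdj, Pi.add_apply, Pi.sub_apply,
      Pi.smul_apply, Pi.zero_apply, smul_eq_mul, ← hrr]
    ring
  have hrank := LinearMap.finrank_range_add_finrank_ker Q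
  have hmono := Submodule.finrank_mono hle
  have hcard : Module.finrank ℝ ((Fin n → Bool) → ℝ) = 2 ^ n := by simp
  have hr0 : 0 ≤ r := Real.sqrt_nonneg _
  rcases lt_or_ge (Module.finrank ℝ (LinearMap.range P)) #W with h | h
  · obtain ⟨v, hv, hPv, hvW⟩ := exists_support_subset_of_finrank_range_lt P W h
    refine ⟨v, hv, fun x => ?_, hvW⟩
    have hx : signedAdj S v x + r * v x = 0 := congrFun hPv x
    rw [eq_neg_of_add_eq_zero_left hx, abs_neg, abs_mul, abs_of_nonneg hr0]
  · obtain ⟨v, hv, hQv, hvW⟩ := exists_support_subset_of_finrank_range_lt Q W (by omega)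
    refine ⟨v, hv, fun x => ?_, hvW⟩
    have hx : signedAdj S v x - r * v x = 0 := congrFun hQv x
    rw [sub_eq_zero.mp hx, abs_mul, abs_of_nonneg hr0]

/-- Huang's theorem: more than half of the vertices of the hypercube induce a subgraph with a
vertex of large degree. -/
theorem exists_card_le_sq_of_half_lt (S : Finset (Fin n)) (W : Finset (Fin n → Bool))
    (hW : 2 ^ n < 2 * #W) :
    ∃ x ∈ W, #S ≤ #{i ∈ S | flip x {i} ∈ W} ^ 2 := by
  obtain ⟨v, hv, hA, hvW⟩ := exists_eigenvector_support_subset S W hW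
  obtain ⟨x, -, hmax⟩ := exists_max_image univ (fun x => |v x|) univ_nonempty
  have hpos : 0 < |v x| := by
    obtain ⟨y, hy⟩ := Function.ne_iff.mp hv
    exact (abs_pos.mpr hy).trans_le (hmax y (mem_univ y))
  refine ⟨x, hvW x (abs_pos.mp hpos), ?_⟩
  have hbound : √(#S) * |v x| ≤ #{i ∈ S | flip x {i} ∈ W} * |v x| := by
    calc √(#S) * |v x| = |∑ i ∈ S, chi (Iio i) x * v (flip x {i})| := by
          rw [← hA, signedAdj_apply]
      _ ≤ ∑ i ∈ S, |chi (Iio i) x * v (flip x {i})| := abs_sum_le_sum_abs _ _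
      _ ≤ ∑ i ∈ S, if flip x {i} ∈ W then |v x| else 0 := by
          refine sum_le_sum fun i _ => ?_
          rw [abs_mul, abs_chi, one_mul]
          split_ifs with hi
          · exact hmax _ (mem_univ _)
          · rw [not_imp_comm.mp (hvW _) hi, abs_zero]
      _ = #{i ∈ S | flip x {i} ∈ W} * |v x| := by
          rw [← sum_filter, sum_const, nsmul_eq_mul]
  have h := Real.sqrt_le_left (x := (#S : ℝ)) (Nat.cast_nonneg #{i ∈ S | flip x {i} ∈ W})
  exact_mod_cast h.mp (le_of_mul_le_mul_right hbound hpos)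

/-! ### Degree versus sensitivity -/

lemma card_le_sensitivity_sq_of_half_lt (f : (Fin n → Bool) → Bool) (S : Finset (Fin n)) (ε : ℝ)
    (hε : ε ≠ 0)
    (hW : 2 ^ n < 2 * #{y : Fin n → Bool | chi S y * sgn (f y) = ε}) :
    #S ≤ sensitivity f ^ 2 := by
  obtain ⟨x, hx, hle⟩ := exists_card_le_sq_of_half_lt S _ hW
  refine hle.trans (Nat.pow_le_pow_left (le_trans (card_le_card fun i hi => ?_)
    (le_sup (f := fun x => localSensitivity f x) (mem_univ x))) 2)
  -- Flipping `i ∈ S` negates `chi S`; staying in the level set therefore forces `f` to change.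
  simp only [mem_filter, mem_univ, true_and] at hi hx ⊢
  intro hf
  have h := hi.2
  rw [chi_flip_singleton, if_pos hi.1, ← hf, mul_assoc, hx] at h
  exact hε (by linarith)

/-- The degree of a boolean function is at most the square of its sensitivity. -/
theorem card_le_sensitivity_sq (f : (Fin n → Bool) → Bool) (S : Finset (Fin n))
    (hS : fourier f S ≠ 0) : #S ≤ sensitivity f ^ 2 := by
  have hval : ∀ y, chi S y * sgn (f y) = 1 ∨ chi S y * sgn (f y) = -1 := fun y =>
    eq_or_eq_neg_of_abs_eq (by rw [abs_mul, abs_chi, abs_sgn, one_mul])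
  have hnot : ∀ y, ¬ chi S y * sgn (f y) = 1 ↔ chi S y * sgn (f y) = -1 := fun y => by
    rcases hval y with h | h <;> rw [h] <;> norm_num
  have hcard := card_filter_add_card_filter_not (s := (univ : Finset (Fin n → Bool)))
    (fun y => chi S y * sgn (f y) = 1)
  have hsum : fourier f S = #{y : Fin n → Bool | chi S y * sgn (f y) = 1} -
      #{y : Fin n → Bool | chi S y * sgn (f y) = -1} := by
    rw [fourier, ← sum_filter_add_sum_filter_not univ (fun y => chi S y * sgn (f y) = 1)]
    simp only [hnot]
    rw [sum_congr rfl fun y hy => (mem_filter.mp hy).2,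
      sum_congr (s₁ := {y | chi S y * sgn (f y) = -1}) rfl fun y hy => (mem_filter.mp hy).2]
    simp [sub_eq_add_neg]
  simp only [hnot, card_univ, Fintype.card_fun, Fintype.card_bool, Fintype.card_fin] at hcard
  have hne : #{y : Fin n → Bool | chi S y * sgn (f y) = 1} ≠
      #{y : Fin n → Bool | chi S y * sgn (f y) = -1} := fun h => hS (by rw [hsum, h, sub_self])
  rcases lt_or_gt_of_ne hne with h | h
  · exact card_le_sensitivity_sq_of_half_lt f S (-1) (by norm_num) (by omega)
  · exact card_le_sensitivity_sq_of_half_lt f S 1 one_ne_zero (by omega)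

section BlockPolynomial

open Polynomial

/-- The expectation, as a polynomial in `t`, of `sgn (f x) * sgn (f y)` where `y` is obtained
from `x` by flipping each block of `F` independently with probability `t`. -/
noncomputable def blockPoly (f : (Fin n → Bool) → Bool) (x : Fin n → Bool) (F : Finset (Finset (Fin n))) :
    ℝ[X] :=
  ∑ J ∈ F.powerset, C (sgn (f x) * sgn (f (flip x (J.biUnion id)))) *
    (X ^ #J * (1 - X) ^ #(F \ J))

lemma abs_eval_blockPoly_le_one (f : (Fin n → Bool) → Bool) (x : Fin n → Bool)
    (F : Finset (Finset (Fin n))) {t : ℝ} (h0 : 0 ≤ t) (h1 : t ≤ 1) :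
    |(blockPoly f x F).eval t| ≤ 1 := by
  have hsum : ∑ J ∈ F.powerset, t ^ #J * (1 - t) ^ #(F \ J) = 1 := by
    have h := prod_add (fun _ => t) (fun _ => 1 - t) F
    simpa using h.symm
  rw [blockPoly, eval_finsetSum]
  refine (abs_sum_le_sum_abs _ _).trans (hsum ▸ sum_le_sum fun J _ => ?_)
  simp [abs_mul, abs_sgn, abs_of_nonneg h0, abs_of_nonneg (sub_nonneg.mpr h1)]

lemma eval_zero_derivative_X_pow_mul (a b : ℕ) :
    (derivative (X ^ a * (1 - X) ^ b : ℝ[X])).eval 0 =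
      (if a = 0 then -(b : ℝ) else 0) + if a = 1 then 1 else 0 := by
  rcases a with _ | _ | a <;> simp [derivative_pow]

lemma eval_zero_derivative_blockPoly (f : (Fin n → Bool) → Bool) (x : Fin n → Bool)
    (F : Finset (Finset (Fin n))) (hF : ∀ B ∈ F, f x ≠ f (flip x B)) :
    (derivative (blockPoly f x F)).eval 0 = -2 * #F := by
  simp only [blockPoly, derivative_sum, eval_finsetSum, derivative_C_mul, eval_C_mul,
    eval_zero_derivative_X_pow_mul, mul_add, sum_add_distrib, mul_ite, mul_zero, mul_one]
  have h1 : ∑ J ∈ F.powerset, (if #J = 1 then sgn (f x) * sgn (f (flip x (J.biUnion id))) else 0)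
      = -#F := by
    rw [← sum_filter, ← powersetCard_eq_filter, powersetCard_one, sum_map]
    simp only [Function.Embedding.coeFn_mk, singleton_biUnion, id]
    rw [sum_congr rfl fun B hB => sgn_mul_of_ne (hF B hB)]
    simp
  rw [h1]
  simp only [card_eq_zero, sum_ite_eq', empty_mem_powerset, if_true, biUnion_empty, flip_empty,
    sgn_mul_self, sdiff_empty]
  ring

/-- A block missing `S` contributes the constant 1, any other a factor of degree at most 1;
disjointness lets at most `#S` blocks meet `S`. -/
lemma natDegree_prod_block_le (F : Finset (Finset (Fin n)))
    (hF : ∀ A ∈ F, ∀ B ∈ F, A ≠ B → Disjoint A B) (S : Finset (Fin n)) :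
    (∏ B ∈ F, (C ((-1) ^ #(S ∩ B)) * X + (1 - X) : ℝ[X])).natDegree ≤ #S := by
  refine (natDegree_prod_le F _).trans ?_
  calc ∑ B ∈ F, (C ((-1) ^ #(S ∩ B)) * X + (1 - X) : ℝ[X]).natDegree
      ≤ ∑ B ∈ F, #(S ∩ B) := by
        refine sum_le_sum fun B _ => ?_
        rcases Nat.eq_zero_or_pos #(S ∩ B) with h | h
        · simp [h]
        · refine le_trans ?_ h
          compute_degree
    _ = #(F.biUnion fun B => S ∩ B) := by
        rw [card_biUnion]
        exact fun A hA B hB hAB => (hF A hA B hB hAB).mono inter_subset_right inter_subset_right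
    _ ≤ #S := card_le_card (biUnion_subset.mpr fun B _ => inter_subset_left)

lemma two_pow_mul_blockPoly (f : (Fin n → Bool) → Bool) (x : Fin n → Bool)
    (F : Finset (Finset (Fin n))) (hF : ∀ A ∈ F, ∀ B ∈ F, A ≠ B → Disjoint A B) :
    C (2 ^ n) * blockPoly f x F = ∑ S, C (sgn (f x) * fourier f S * chi S x) *
      ∏ B ∈ F, (C ((-1) ^ #(S ∩ B)) * X + (1 - X)) := by
  have hsign : ∀ S, ∀ J ∈ F.powerset,
      ((-1) ^ #(S ∩ J.biUnion id) : ℝ) = ∏ B ∈ J, (-1) ^ #(S ∩ B) := by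
    intro S J hJ
    rw [mem_powerset] at hJ
    rw [prod_pow_eq_pow_sum, inter_biUnion, card_biUnion]
    · rfl
    · exact fun A hA B hB hAB =>
        (hF A (hJ hA) B (hJ hB) hAB).mono inter_subset_right inter_subset_right
  simp only [prod_add, blockPoly, mul_sum]
  rw [sum_comm]
  refine sum_congr rfl fun J hJ => ?_
  rw [← mul_assoc, ← C_mul, mul_left_comm (2 ^ n : ℝ), ← sum_fourier_mul_chi, mul_sum, map_sum, sum_mul]
  refine sum_congr rfl fun S _ => ?_
  rw [chi_flip, hsign S J hJ, prod_mul_distrib, prod_const, prod_const, ← map_prod]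
  simp only [C_mul]
  ring

lemma natDegree_blockPoly_le (f : (Fin n → Bool) → Bool) (x : Fin n → Bool)
    (F : Finset (Finset (Fin n))) (hF : ∀ A ∈ F, ∀ B ∈ F, A ≠ B → Disjoint A B) :
    (blockPoly f x F).natDegree ≤ sensitivity f ^ 2 := by
  rw [← natDegree_C_mul (pow_ne_zero n (two_ne_zero (α := ℝ))), two_pow_mul_blockPoly f x F hF]
  refine natDegree_sum_le_of_forall_le _ _ fun S _ => ?_
  by_cases hS : fourier f S = 0
  · simp [hS]
  · exact (natDegree_C_mul_le _ _).trans
      ((natDegree_prod_block_le F hF S).trans (card_le_sensitivity_sq f S hS))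

lemma card_le_sensitivity_pow_four (f : (Fin n → Bool) → Bool) (x : Fin n → Bool)
    (F : Finset (Finset (Fin n))) (hF : IsSensitiveFamily f x F) :
    #F ≤ sensitivity f ^ 4 := by
  set d := sensitivity f ^ 2 with hd
  -- `L` maps `[-1,1]` onto `[0,1]` and sends 1 to 0, where the Chebyshev bound `T_d'(1) = d^2`
  -- applies; its slope `-1/2` turns `-2 * #F` into `#F`.
  set L : ℝ[X] := C (1 / 2) * (1 - X) with hL
  have hLdeg : L.natDegree ≤ 1 := by
    rw [hL]
    compute_degree
  have hdeg : ((blockPoly f x F).comp L).degree ≤ d := by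
    refine natDegree_le_iff_degree_le.mp (natDegree_comp_le.trans ?_)
    calc _ ≤ d * 1 := Nat.mul_le_mul (natDegree_blockPoly_le f x F hF.1) hLdeg
      _ = d := mul_one d
  have hbound : ∀ t ∈ Set.Icc (-1 : ℝ) 1, |((blockPoly f x F).comp L).eval t| ≤ 1 := by
    rintro t ⟨ht0, ht1⟩
    rw [eval_comp]
    apply abs_eval_blockPoly_le_one <;> simp [hL] <;> linarith
  have h := Chebyshev.eval_iterate_derivative_le_of_forall_abs_le_one (k := 1) le_rfl hdeg hbound
  have hL1 : L.eval 1 = 0 := by simp [hL]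
  have hL' : (derivative L).eval 1 = -(1 / 2) := by simp [hL]
  rw [Function.iterate_one, Chebyshev.derivative_T_eval_one, derivative_comp, eval_mul, eval_comp,
    hL1, hL', eval_zero_derivative_blockPoly f x F hF.2] at h
  have hk : (#F : ℝ) ≤ (d : ℝ) ^ 2 := by
    push_cast at h
    linarith
  calc #F ≤ d ^ 2 := by exact_mod_cast hk
    _ = sensitivity f ^ 4 := by rw [hd, ← pow_mul]

end BlockPolynomial

end BooleanFunction

theorem mainTheorem3 (n : ℕ) (f : (Fin n → Bool) → Bool) :
    BooleanFunction.blockSensitivity f ≤ BooleanFunction.sensitivity f ^ 4 := by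
  refine Finset.sup_le fun x _ => Finset.sup_le fun F hF => ?_
  exact BooleanFunction.card_le_sensitivity_pow_four f x F (Finset.mem_filter.mp hF).2
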